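/- \textbf{Definitions.} $\mathcal S_n$ is the set of permutations $\sigma=\sigma_1\cdots\sigma_n$ of $\{1,\dots,n\}$. An occurrence of a pattern $\tau\in\mathcal S_j$ in $\sigma\in\mathcal S_n$ is a choice of indices $\ell_1<\cdots<\ell_j$ such that $\sigma_{\ell_1}\cdots\sigma_{\ell_j}$ is in the same relative order as $\tau_1\cdots\tau_j$; $\mathrm{occr}_\tau(\sigma)$ is the number of occurrences, and $\mathcal S_n(\tau)$ is the set of $\sigma\in\mathcal S_n$ with no occurrence of $\tau$. Put $$Q_\lambda^\gamma(t,x)=1+\sum_{n\ge1}t^n\sum_{\sigma\in\mathcal S_n(\lambda)}x^{\mathrm{occr}_\gamma(\sigma)} .$$ An $(n,n)$-Dyck path is a path of unit down-steps $D$ and unit right-steps $R$ from the top left corner to the bottom right corner of an $n\times n$ square which stays weakly below the main diagonal. A peak is a position of consecutive steps $DR$; it is on the $d$-th diagonal if the point where these two steps start is $d$ units below the main diagonal. For $\sigma\in\mathcal S_n$, place $\sigma_i$ in the $i$-th column from the left and the $\sigma_i$-th row from the bottom of an $n\times n$ table, and shade all cells weakly to the north-east of a cell containing an entry; let $P(\sigma)$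 be the $(n,n)$-Dyck path along the south-west boundary of the shaded cells. Write $\Phi$ and $\Psi$ for the restrictions of $\sigma\mapsto P(\sigma)$ to $\mathcal S_n(132)$ and to $\mathcal S_n(123)$. \textbf{Theorem.} Let $n,i,j$ be nonnegative integers with $i<j$, and let $\mathcal D_{n}^{i,j}$ be the set of $(n,n)$-Dyck paths with exactly $i$ peaks on the $(j-1)$-st diagonal and no peaks on the $k$-th diagonal for any $k\ge j$. Then: \begin{enumerate} \item the coefficient of $t^nx^i$ in $Q_{132}^{12\cdots j}(t,x)$ equals the coefficient of $t^nx^i$ in $Q_{123}^{1j(j-1)\cdots2}(t,x)$; equivalently, $$|\{\sigma\in\mathcal S_n(132):\mathrm{occr}_{12\cdots j}(\sigma)=i\}|=|\{\sigma\in\mathcal S_n(123):\mathrm{occr}_{1j(j-1)\cdots2}(\sigma)=i\}|;$$ \item for $\sigma\in\mathcal S_n(132)$, $\mathrm{occr}_{12\cdots j}(\sigma)=i$ if and only if $\Phi(\sigma)\in\mathcal D_n^{i,j}$, and $\Phi$ maps $\{\sigma\in\mathcal S_n(132):\mathrm{occr}_{12\cdots j}(\sigma)=i\}$ bijectively onto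 $\mathcal D_n^{i,j}$; \item for $\sigma\in\mathcal S_n(123)$, $\mathrm{occr}_{1j(j-1)\cdots2}(\sigma)=i$ if and only if $\Psi(\sigma)\in\mathcal D_n^{i,j}$, and $\Psi$ maps $\{\sigma\in\mathcal S_n(123):\mathrm{occr}_{1j(j-1)\cdots2}(\sigma)=i\}$ bijectively onto $\mathcal D_n^{i,j}$. \end{enumerate} -/

import Mathlib

open Finset

namespace PermPattern

/-- The index map `f` picks out an occurrence of the pattern `τ ∈ S_j` in `σ ∈ S_n`: the indices
`f 0 < f 1 < ⋯` increase, and the selected entries of `σ` are in the same relative order as the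
entries of `τ`. (Permutations of size `n` act on `Fin n = {0, …, n - 1}`, so the entry `σ_i` of the
one-line notation is `σ (i - 1) + 1`.) -/
def IsOccurrence {j n : ℕ} (τ : Equiv.Perm (Fin j)) (σ : Equiv.Perm (Fin n))
    (f : Fin j → Fin n) : Prop :=
  (∀ a b, a < b → f a < f b) ∧ ∀ a b, σ (f a) < σ (f b) ↔ τ a < τ b

instance {j n : ℕ} (τ : Equiv.Perm (Fin j)) (σ : Equiv.Perm (Fin n)) :
    DecidablePred (IsOccurrence τ σ) :=
  fun f => inferInstanceAs (Decidable
    ((∀ a b, a < b → f a < f b) ∧ ∀ a b, σ (f a) < σ (f b) ↔ τ a < τ b))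

/-- `occr τ σ` is the number of occurrences of the pattern `τ` in `σ`. -/
def occr {j n : ℕ} (τ : Equiv.Perm (Fin j)) (σ : Equiv.Perm (Fin n)) : ℕ :=
  #{f : Fin j → Fin n | IsOccurrence τ σ f}

/-- `avoiders n τ` is the set `S_n(τ)` of permutations of size `n` in which `τ` does not occur. -/
def avoiders {j : ℕ} (n : ℕ) (τ : Equiv.Perm (Fin j)) : Finset (Equiv.Perm (Fin n)) :=
  {σ | ¬ ∃ f, IsOccurrence τ σ f}

/-- The pattern `12⋯j`. -/
def increasing (j : ℕ) : Equiv.Perm (Fin j) := 1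

/-- The underlying map of the pattern `1j(j-1)⋯2`: the first entry is `1`, and the entry at the
(zero-based) position `a ≥ 1` is `j - a + 1`. -/
def oneThenDecreasingFun (j : ℕ) (a : Fin j) : Fin j :=
  ⟨if a.val = 0 then 0 else j - a.val, by have := a.isLt; split <;> omega⟩

theorem oneThenDecreasingFun_involutive (j : ℕ) :
    Function.Involutive (oneThenDecreasingFun j) := by
  intro a
  have := a.isLt
  ext
  simp only [oneThenDecreasingFun]
  split_ifs <;> omega

/-- The pattern `1j(j-1)⋯2`. -/
def oneThenDecreasing (j : ℕ) : Equiv.Perm (Fin j) :=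
  (oneThenDecreasingFun_involutive j).toPerm

/-- The pattern `123`. -/
def p123 : Equiv.Perm (Fin 3) := 1

/-- The pattern `132`. -/
def p132 : Equiv.Perm (Fin 3) := Equiv.swap 1 2

/-- The polynomial `Q_{n,τ}^γ(x) = ∑_{σ ∈ S_n(τ)} x ^ occr_γ(σ)`. -/
noncomputable def Qpoly {m j : ℕ} (τ : Equiv.Perm (Fin m)) (γ : Equiv.Perm (Fin j)) (n : ℕ) :
    Polynomial ℤ :=
  ∑ σ ∈ avoiders n τ, Polynomial.X ^ occr γ σ

/-- The generating function `Q_τ^γ(t,x) = 1 + ∑_{n ≥ 1} t ^ n Q_{n,τ}^γ(x)`, as a power series in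
`t` whose coefficients are polynomials in `x`. -/
noncomputable def Q {m j : ℕ} (τ : Equiv.Perm (Fin m)) (γ : Equiv.Perm (Fin j)) :
    PowerSeries (Polynomial ℤ) :=
  PowerSeries.mk fun n => if n = 0 then 1 else Qpoly τ γ n

/-! ### Dyck paths

An `(n,n)`-Dyck path runs from the top left corner `(0,0)` to the bottom right corner `(n,n)` of an
`n × n` square by unit down-steps and unit right-steps, and stays weakly below the main diagonal.
It is a Mathlib `DyckWord` of semilength `n`. -/

/-- A unit down-step. -/
abbrev down : DyckStep := DyckStep.U

/-- A unit right-step. -/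
abbrev right : DyckStep := DyckStep.D

/-- The number of peaks of `P` on the `d`-th diagonal: the number of positions `m` where a down-step
is directly followed by a right-step, such that the point reached after the first `m` steps is `d`
units below the main diagonal. -/
def peaksOnDiagonal (P : DyckWord) (d : ℕ) : ℕ :=
  #{m ∈ range P.toList.length | P.toList[m]? = some down ∧ P.toList[m + 1]? = some right ∧
    (P.toList.take m).count down = (P.toList.take m).count right + d}

/-- In the graph of `σ` (the `n × n` table with `σ_i` in column `i` from the left and row `σ_i` from
the bottom) shade all cells weakly to the north-east of a cell containing an entry. For
`1 ≤ k ≤ n`, `shadedDepth σ k` is the number of shaded cells in column `k`; these are the topmost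
cells of the column. Also `shadedDepth σ 0 = 0`. -/
def shadedDepth {n : ℕ} (σ : Equiv.Perm (Fin n)) (k : ℕ) : ℕ :=
  #{r : Fin n | ∃ i : Fin n, i.val < k ∧ σ i ≤ r}

/-- The steps of the south-west boundary of the shaded cells, through the first `k` columns: in each
column go down to the bottom of the shaded cells of that column, then one step to the right. -/
def boundarySteps {n : ℕ} (σ : Equiv.Perm (Fin n)) : ℕ → List DyckStep
  | 0 => []
  | k + 1 => boundarySteps σ k ++
      (List.replicate (shadedDepth σ (k + 1) - shadedDepth σ k) down ++ [right])

theorem shadedDepth_zero {n : ℕ} (σ : Equiv.Perm (Fin n)) : shadedDepth σ 0 = 0 := by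
  simp [shadedDepth]

theorem shadedDepth_mono {n : ℕ} (σ : Equiv.Perm (Fin n)) (k : ℕ) :
    shadedDepth σ k ≤ shadedDepth σ (k + 1) := by
  apply Finset.card_le_card
  intro r hr
  simp only [mem_filter, mem_univ, true_and] at hr ⊢
  obtain ⟨i, hi, h⟩ := hr
  exact ⟨i, by omega, h⟩

theorem le_shadedDepth {n : ℕ} (σ : Equiv.Perm (Fin n)) {k : ℕ} (hk : k ≤ n) :
    k ≤ shadedDepth σ k := by
  have h : ((univ : Finset (Fin k)).map
      ((Fin.castLEEmb hk).trans σ.toEmbedding)).card ≤ shadedDepth σ k := by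
    apply Finset.card_le_card
    intro r hr
    simp only [mem_map, mem_univ, true_and] at hr
    obtain ⟨a, rfl⟩ := hr
    simp only [mem_filter, mem_univ, true_and]
    exact ⟨Fin.castLE hk a, by simp, le_rfl⟩
  simpa using h

theorem shadedDepth_self {n : ℕ} (σ : Equiv.Perm (Fin n)) : shadedDepth σ n = n :=
  le_antisymm ((Finset.card_le_univ _).trans (by simp)) (le_shadedDepth σ le_rfl)

theorem count_down_boundarySteps {n : ℕ} (σ : Equiv.Perm (Fin n)) (k : ℕ) :
    (boundarySteps σ k).count down = shadedDepth σ k := by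
  induction k with
  | zero => simp [boundarySteps, shadedDepth_zero]
  | succ k ih =>
    have := shadedDepth_mono σ k
    simp [boundarySteps, ih]
    omega

theorem count_right_boundarySteps {n : ℕ} (σ : Equiv.Perm (Fin n)) (k : ℕ) :
    (boundarySteps σ k).count right = k := by
  induction k with
  | zero => simp [boundarySteps]
  | succ k ih => simp [boundarySteps, ih, List.count_replicate]

theorem count_take_boundarySteps {n : ℕ} (σ : Equiv.Perm (Fin n)) {k : ℕ} (hk : k ≤ n) (m : ℕ) :
    ((boundarySteps σ k).take m).count right ≤ ((boundarySteps σ k).take m).count down := by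
  induction k with
  | zero => simp [boundarySteps]
  | succ k ih =>
    have hd := le_shadedDepth σ hk
    have h1 := shadedDepth_mono σ k
    rcases le_total m (boundarySteps σ k).length with hm | hm
    · rw [boundarySteps, List.take_append_of_le_length hm]
      exact ih (by omega)
    · have hr := count_right_boundarySteps σ k
      have hw := count_down_boundarySteps σ k
      have h0 := le_shadedDepth σ (k := k) (by omega)
      rw [boundarySteps, List.take_append, List.take_of_length_le hm, List.count_append,
        List.count_append, hr, hw, List.take_append, List.count_append, List.count_append]
      generalize m - (boundarySteps σ k).length = p
      rw [List.take_replicate, List.length_replicate]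
      rcases Nat.eq_zero_or_pos (p - (shadedDepth σ (k + 1) - shadedDepth σ k)) with hp | hp
      · simp [hp, List.count_replicate]
        omega
      · rw [List.take_of_length_le (l := [right]) (by simp only [List.length_singleton]; omega)]
        simp [List.count_replicate]
        omega

/-- The Dyck path along the south-west boundary of the shaded cells of the graph of `σ`. Its
restrictions to `S_n(132)` and `S_n(123)` are the classical bijections `Φ` (Krattenthaler) and `Ψ`
(Elizalde and Deutsch) to the `(n,n)`-Dyck paths. -/
def boundaryPath {n : ℕ} (σ : Equiv.Perm (Fin n)) : DyckWord where
  toList := boundarySteps σ n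
  count_U_eq_count_D := by
    rw [count_down_boundarySteps, count_right_boundarySteps, shadedDepth_self]
  count_D_le_count_U := count_take_boundarySteps σ le_rfl

/-- The `(n,n)`-Dyck paths with exactly `i` peaks on the diagonal `j - 1` and no peaks on the
diagonals `k ≥ j` (used for `j ≥ 1` only). -/
def pathsWithTopPeaks (n i j : ℕ) : Set DyckWord :=
  {P | P.semilength = n ∧ peaksOnDiagonal P (j - 1) = i ∧ ∀ k, j ≤ k → peaksOnDiagonal P k = 0}

end PermPattern

/-! In a permutation avoiding 132, entries that lie to the right of a given entry and exceed it must
increase; if 123 is avoided, they must decrease. In both classes an occurrence of the pattern in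
question is therefore an entry together with any `j - 1` of the `r_k` larger entries to its right,
and the number of occurrences is the sum over positions `k` of `r_k` choose `j - 1`.

Since `i < j`, a single `r_k ≥ j` would already contribute at least `j > i`. A sum equal to `i` thus
means that every `r_k` is at most `j - 1` and that exactly `i` of them equal `j - 1`. A position
where `r_k` is maximal is a left-to-right minimum, so only left-to-right minima matter
(`sum_choose_eq_iff`). These are the peaks of the boundary path, and the peak at `k` is on the
diagonal `r_k` (`peaksOnDiagonal_boundaryPath`).

For bijectivity, the path carries the same information as the sequence of running minima. Given
these, an avoider is rebuilt greedily from left to right: avoiding 132 forces the smallest unused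
value not below the running minimum; avoiding 123 forces the running minimum itself if unused, and
otherwise the largest unused value. Lying below the diagonal ensures that a value is always
available (`exists_greedy_perm`). -/

namespace PermPattern

/-! ### Counting occurrences -/

/-- The positions to the right of `k` with a larger entry. -/
def largerRight {n : ℕ} (σ : Equiv.Perm (Fin n)) (k : Fin n) : Finset (Fin n) :=
  {c | k < c ∧ σ k < σ c}

/-- The entry at position `k` is a left-to-right minimum. -/
def IsLeftMin {n : ℕ} (σ : Equiv.Perm (Fin n)) (k : Fin n) : Prop :=
  ∀ i, i < k → σ k < σ i

/-- Once the first index is `k`, the remaining indices are an arbitrary `j`-subset of `largerRight σ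
k`, listed in increasing order. -/
theorem card_strictMono_above {n : ℕ} (σ : Equiv.Perm (Fin n)) (j : ℕ) (k : Fin n) :
    #{f : Fin (j + 1) → Fin n | (StrictMono f ∧ ∀ a : Fin j, σ (f 0) < σ (f a.succ)) ∧ f 0 = k} =
      (#(largerRight σ k)).choose j := by
  classical
  rw [← card_powersetCard]
  refine card_bij (fun f _ => univ.image (fun a : Fin j => f a.succ)) ?_ ?_ ?_
  · intro f hf
    simp only [mem_filter, mem_univ, true_and] at hf
    obtain ⟨⟨hm, hs⟩, rfl⟩ := hf
    rw [mem_powersetCard]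
    constructor
    · intro c hc
      simp only [mem_image, mem_univ, true_and] at hc
      obtain ⟨a, rfl⟩ := hc
      simp only [largerRight, mem_filter, mem_univ, true_and]
      exact ⟨hm (Fin.succ_pos a), hs a⟩
    · rw [card_image_of_injective, card_univ, Fintype.card_fin]
      exact hm.injective.comp (Fin.succ_injective j)
  · intro f hf g hg hfg
    simp only [mem_filter, mem_univ, true_and] at hf hg
    have hr : Set.range (fun a : Fin j => f a.succ) = Set.range (fun a : Fin j => g a.succ) := by
      have := congrArg (fun s : Finset (Fin n) => (s : Set (Fin n))) hfg
      simpa using this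
    have h1 : StrictMono (fun a : Fin j => f a.succ) := hf.1.1.comp (Fin.strictMono_succ)
    have h2 : StrictMono (fun a : Fin j => g a.succ) := hg.1.1.comp (Fin.strictMono_succ)
    have h3 := (h1.range_inj h2).1 hr
    funext a
    refine Fin.cases ?_ (fun b => ?_) a
    · rw [hf.2, hg.2]
    · exact congrFun h3 b
  · intro S hS
    rw [mem_powersetCard] at hS
    have hmem : ∀ a, k < S.orderEmbOfFin hS.2 a ∧ σ k < σ (S.orderEmbOfFin hS.2 a) := by
      intro a
      simpa [largerRight] using hS.1 (orderEmbOfFin_mem S hS.2 a)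
    refine ⟨Fin.cons k (S.orderEmbOfFin hS.2), ?_, ?_⟩
    · simp only [mem_filter, mem_univ, true_and, Fin.cons_zero, Fin.cons_succ, and_true]
      refine ⟨?_, fun a => (hmem a).2⟩
      intro a b
      refine Fin.cases ?_ (fun a => ?_) a <;> refine Fin.cases ?_ (fun b => ?_) b
      · simp
      · intro _
        simpa using (hmem b).1
      · intro h
        exact absurd h (Fin.not_lt_zero _)
      · intro h
        simpa using h
    · simp

/-- If the occurrences of `γ` are the increasing index maps whose first entry is minimal, then they
are counted by binomial coefficients. -/
theorem occr_eq_sum_choose {n j : ℕ} (σ : Equiv.Perm (Fin n)) (γ : Equiv.Perm (Fin (j + 1)))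
    (h : ∀ f, IsOccurrence γ σ f ↔ StrictMono f ∧ ∀ a : Fin j, σ (f 0) < σ (f a.succ)) :
    occr γ σ = ∑ k, (#(largerRight σ k)).choose j := by
  classical
  rw [occr, filter_congr (fun f _ => h f), card_eq_sum_card_fiberwise (f := fun f => f 0)
    (t := univ) (fun _ _ => mem_univ _)]
  refine sum_congr rfl fun k _ => ?_
  rw [filter_filter, ← card_strictMono_above]

theorem mem_avoiders_iff {n j : ℕ} {τ : Equiv.Perm (Fin j)} {σ : Equiv.Perm (Fin n)} :
    σ ∈ avoiders n τ ↔ ∀ f, ¬ IsOccurrence τ σ f := by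
  simp [avoiders]

theorem mem_avoiders_p123 {n : ℕ} {σ : Equiv.Perm (Fin n)} :
    σ ∈ avoiders n p123 ↔ ∀ a b c, a < b → b < c → σ a < σ b → ¬ σ b < σ c := by
  rw [mem_avoiders_iff]
  constructor
  · intro h a b c hab hbc h1 h2
    refine h ![a, b, c] ⟨?_, ?_⟩
    · simp [Fin.forall_fin_succ, hab, hbc, hab.trans hbc]
    · simp [Fin.forall_fin_succ, p123, h1, h2, h1.trans h2, h1.le, h2.le, (h1.trans h2).le]
  · rintro h f ⟨hf, ho⟩
    exact h (f 0) (f 1) (f 2) (hf _ _ (by decide)) (hf _ _ (by decide))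
      ((ho _ _).2 (by decide)) ((ho _ _).2 (by decide))

theorem mem_avoiders_p132 {n : ℕ} {σ : Equiv.Perm (Fin n)} :
    σ ∈ avoiders n p132 ↔ ∀ a b c, a < b → b < c → σ a < σ c → ¬ σ c < σ b := by
  rw [mem_avoiders_iff]
  constructor
  · intro h a b c hab hbc h1 h2
    refine h ![a, b, c] ⟨?_, ?_⟩
    · simp [Fin.forall_fin_succ, hab, hbc, hab.trans hbc]
    · have e0 : p132 0 = 0 := by decide
      have e1 : p132 1 = 2 := by decide
      have e2 : p132 2 = 1 := by decide
      simp [Fin.forall_fin_succ, e0, e1, e2, h1, h2, h1.trans h2, h1.le, h2.le, (h1.trans h2).le]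
  · rintro h f ⟨hf, ho⟩
    exact h (f 0) (f 1) (f 2) (hf _ _ (by decide)) (hf _ _ (by decide))
      ((ho _ _).2 (by decide)) ((ho _ _).2 (by decide))

/-- A descent among the later entries would form a 132 with the first one. -/
theorem isOccurrence_increasing_iff {n j : ℕ} {σ : Equiv.Perm (Fin n)} (hσ : σ ∈ avoiders n p132)
    (f : Fin (j + 1) → Fin n) : IsOccurrence (increasing (j + 1)) σ f ↔
      StrictMono f ∧ ∀ a : Fin j, σ (f 0) < σ (f a.succ) := by
  rw [mem_avoiders_p132] at hσ
  constructor
  · rintro ⟨h1, h2⟩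
    exact ⟨fun a b => h1 a b, fun a => (h2 _ _).2 (Fin.succ_pos a)⟩
  · rintro ⟨h1, h2⟩
    have key : StrictMono (fun a => σ (f a)) := by
      intro a b
      refine Fin.cases ?_ (fun a => ?_) a <;> refine Fin.cases ?_ (fun b => ?_) b
      · simp
      · exact fun _ => h2 b
      · exact fun h => absurd h (Fin.not_lt_zero _)
      · intro h
        have hne : σ (f a.succ) ≠ σ (f b.succ) := fun e => (h1 h).ne (σ.injective e)
        exact lt_of_le_of_ne (not_lt.1 (hσ _ _ _ (h1 (Fin.succ_pos a)) (h1 h) (h2 b))) hne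
    exact ⟨fun a b h => h1 h, fun a b => key.lt_iff_lt⟩

/-- An ascent among the later entries would form a 123 with the first one. -/
theorem isOccurrence_oneThenDecreasing_iff {n j : ℕ} {σ : Equiv.Perm (Fin n)}
    (hσ : σ ∈ avoiders n p123) (f : Fin (j + 1) → Fin n) :
    IsOccurrence (oneThenDecreasing (j + 1)) σ f ↔
      StrictMono f ∧ ∀ a : Fin j, σ (f 0) < σ (f a.succ) := by
  rw [mem_avoiders_p123] at hσ
  have e0 : (oneThenDecreasing (j + 1) 0).val = 0 := by
    simp [oneThenDecreasing, oneThenDecreasingFun]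
  have es : ∀ a : Fin j, (oneThenDecreasing (j + 1) a.succ).val = j - a.val := by
    intro a
    simp [oneThenDecreasing, oneThenDecreasingFun]
  constructor
  · rintro ⟨h1, h2⟩
    refine ⟨fun a b => h1 a b, fun a => (h2 _ _).2 ?_⟩
    rw [Fin.lt_def, e0, es]
    omega
  · rintro ⟨h1, h2⟩
    have key : StrictAnti (fun a : Fin j => σ (f a.succ)) := by
      intro a b h
      have h' : a.succ < b.succ := by simpa using h
      have hne : σ (f a.succ) ≠ σ (f b.succ) := fun e => (h1 h').ne (σ.injective e)
      exact lt_of_le_of_ne (not_lt.1 (hσ _ _ _ (h1 (Fin.succ_pos a)) (h1 h') (h2 a))) hne.symm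
    refine ⟨fun a b h => h1 h, fun a b => ?_⟩
    rw [Fin.lt_def (a := oneThenDecreasing _ a)]
    refine Fin.cases ?_ (fun a => ?_) a <;> refine Fin.cases ?_ (fun b => ?_) b
    · simp
    · rw [e0, es]
      exact iff_of_true (h2 b) (by omega)
    · rw [e0, es]
      exact iff_of_false (h2 a).not_gt (by omega)
    · rw [es, es, key.lt_iff_gt, Fin.lt_def]
      omega

/-- An earlier smaller entry `i` sees everything that `k` sees, and `k` as well. -/
theorem card_largerRight_lt {n : ℕ} (σ : Equiv.Perm (Fin n)) {k : Fin n} (hk : ¬ IsLeftMin σ k) :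
    ∃ i, #(largerRight σ k) < #(largerRight σ i) := by
  simp only [IsLeftMin, not_forall, not_lt] at hk
  obtain ⟨i, hik, hle⟩ := hk
  have hlt : σ i < σ k := lt_of_le_of_ne hle fun e => hik.ne (σ.injective e)
  refine ⟨i, card_lt_card ?_⟩
  rw [ssubset_iff_of_subset]
  · exact ⟨k, by simp [largerRight, hik, hlt], by simp [largerRight]⟩
  · intro c hc
    simp only [largerRight, mem_filter, mem_univ, true_and] at hc ⊢
    exact ⟨hik.trans hc.1, hlt.trans hc.2⟩

theorem isLeftMin_of_card_maximal {n : ℕ} (σ : Equiv.Perm (Fin n)) {k : Fin n}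
    (hk : ∀ i, #(largerRight σ i) ≤ #(largerRight σ k)) : IsLeftMin σ k := by
  by_contra h
  obtain ⟨i, hi⟩ := card_largerRight_lt σ h
  exact absurd (hk i) (by omega)

-- Here `j + 1` is the length of the pattern. If all `largerRight` counts are at most `j`, each
-- binomial coefficient is 0 or 1, and it is 1 only where the count attains its maximum `j`, hence
-- at a left-to-right minimum. Both sides of the equivalence force this bound.
open Classical in
theorem sum_choose_eq_iff {n i j : ℕ} (hij : i < j + 1) (σ : Equiv.Perm (Fin n)) :
    ∑ k, (#(largerRight σ k)).choose j = i ↔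
      #{k | IsLeftMin σ k ∧ #(largerRight σ k) = j} = i ∧
        ∀ d, j + 1 ≤ d → #{k | IsLeftMin σ k ∧ #(largerRight σ k) = d} = 0 := by
  have main : (∀ k, #(largerRight σ k) ≤ j) → ∑ k, (#(largerRight σ k)).choose j =
      #{k | IsLeftMin σ k ∧ #(largerRight σ k) = j} := by
    intro h
    rw [card_filter]
    refine sum_congr rfl fun k _ => ?_
    rcases (h k).lt_or_eq with hk | hk
    · rw [Nat.choose_eq_zero_of_lt hk, if_neg (fun H => hk.ne H.2)]
    · rw [if_pos ⟨isLeftMin_of_card_maximal σ (fun i => (h i).trans hk.ge), hk⟩, hk,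
        Nat.choose_self]
  constructor
  · intro h
    have hle : ∀ k, #(largerRight σ k) ≤ j := by
      intro k
      by_contra! hk
      have h1 : (#(largerRight σ k)).choose j ≤ i := h ▸ single_le_sum
        (f := fun k => (#(largerRight σ k)).choose j) (fun _ _ => Nat.zero_le _) (mem_univ k)
      -- One term would already be at least `j + 1`, which exceeds `i`.
      have h2 : (j + 1).choose j ≤ (#(largerRight σ k)).choose j := Nat.choose_le_choose j hk
      rw [Nat.choose_succ_self_right] at h2
      omega
    refine ⟨(main hle).symm.trans h, fun d hd => ?_⟩
    rw [card_eq_zero, filter_eq_empty_iff]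
    rintro k - ⟨-, hk⟩
    have := hle k
    omega
  · rintro ⟨h1, h2⟩
    rw [main, h1]
    intro k
    -- It suffices to bound the maximum: it occurs at a left-to-right minimum, so a value above `j`
    -- would contradict `h2` for that diagonal.
    obtain ⟨k', -, hk'⟩ := exists_max_image univ (fun k => #(largerRight σ k)) ⟨k, mem_univ k⟩
    refine (hk' k (mem_univ k)).trans ?_
    by_contra! hlt
    have := h2 _ hlt
    rw [card_eq_zero, filter_eq_empty_iff] at this
    exact this (mem_univ k') ⟨isLeftMin_of_card_maximal σ fun i => hk' i (mem_univ i), rfl⟩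

/-! ### Step sequences -/

/-- The step sequence with `k` right-steps in which `h l` down-steps precede the `l`-th right-step. -/
def depthSteps (h : ℕ → ℕ) : ℕ → List DyckStep
  | 0 => []
  | k + 1 => depthSteps h k ++ (List.replicate (h (k + 1) - h k) down ++ [right])

theorem boundarySteps_eq {n : ℕ} (σ : Equiv.Perm (Fin n)) (k : ℕ) :
    boundarySteps σ k = depthSteps (shadedDepth σ) k := by
  induction k with
  | zero => rfl
  | succ k ih => rw [boundarySteps, ih, depthSteps]

theorem depthSteps_congr {h h' : ℕ → ℕ} {k : ℕ} (hh : ∀ l ≤ k, h l = h' l) :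
    depthSteps h k = depthSteps h' k := by
  induction k with
  | zero => rfl
  | succ k ih =>
    rw [depthSteps, depthSteps, ih fun l hl => hh l (by omega), hh (k + 1) le_rfl, hh k (by omega)]

theorem count_right_depthSteps (h : ℕ → ℕ) (k : ℕ) : (depthSteps h k).count right = k := by
  induction k with
  | zero => simp [depthSteps]
  | succ k ih => simp [depthSteps, ih, List.count_replicate]

theorem count_down_depthSteps {h : ℕ → ℕ} (h0 : h 0 = 0) (hm : Monotone h) (k : ℕ) :
    (depthSteps h k).count down = h k := by
  induction k with
  | zero => simp [depthSteps, h0]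
  | succ k ih =>
    have := hm (Nat.le_succ k)
    simp only [Nat.succ_eq_add_one] at this
    simp [depthSteps, ih]
    omega

theorem depthSteps_prefix (h : ℕ → ℕ) {k l : ℕ} (hkl : k ≤ l) :
    depthSteps h k <+: depthSteps h l := by
  induction l, hkl using Nat.le_induction with
  | base => exact List.prefix_rfl
  | succ l _ ih => exact ih.trans (List.prefix_append _ _)

/-- The two sequences have equally many right-steps and, when `k > 0`, the longer one ends in a
right-step, so the remainder must be empty. -/
theorem depthSteps_eq_of_prefix {h h' : ℕ → ℕ} {k : ℕ}
    (hp : depthSteps h k <+: depthSteps h' k) : depthSteps h k = depthSteps h' k := by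
  cases k with
  | zero => rfl
  | succ k =>
    obtain ⟨T, hT⟩ := hp
    have hc := congrArg (List.count right) hT
    rw [List.count_append, count_right_depthSteps, count_right_depthSteps] at hc
    rcases List.eq_nil_or_concat T with rfl | ⟨T', x, rfl⟩
    · simpa using hT
    · rw [show depthSteps h' (k + 1) = depthSteps h' k ++
        (List.replicate (h' (k + 1) - h' k) down ++ [right]) from rfl, List.concat_eq_append,
        ← List.append_assoc, ← List.append_assoc] at hT
      have := (List.append_inj' hT rfl).2
      simp only [List.cons.injEq, and_true] at this
      subst this
      simp at hc

/-- Cutting the common sequence right after its `k`-th right-step leaves a prefix whose down-steps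
number both `h k` and `h' k`. -/
theorem depthSteps_injective {h h' : ℕ → ℕ} {n : ℕ} (h0 : h 0 = 0) (hm : Monotone h)
    (h0' : h' 0 = 0) (hm' : Monotone h') (he : depthSteps h n = depthSteps h' n) {k : ℕ}
    (hk : k ≤ n) : h k = h' k := by
  have p := depthSteps_prefix h hk
  have p' := depthSteps_prefix h' hk
  rw [he] at p
  have heq : depthSteps h k = depthSteps h' k := by
    rcases List.prefix_or_prefix_of_prefix p p' with q | q
    · exact depthSteps_eq_of_prefix q
    · exact (depthSteps_eq_of_prefix q).symm
  rw [← count_down_depthSteps h0 hm, heq, count_down_depthSteps h0' hm']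

theorem exists_depthSteps (L : List DyckStep) :
    ∃ h : ℕ → ℕ, h 0 = 0 ∧ Monotone h ∧ ∃ t,
      L = depthSteps h (L.count right) ++ List.replicate t down := by
  induction L using List.reverseRecOn with
  | nil => exact ⟨fun _ => 0, rfl, monotone_const, 0, by simp [depthSteps]⟩
  | append_singleton L x ih =>
    obtain ⟨h, h0, hm, t, ht⟩ := ih
    generalize L.count right = k at ht
    have hc : L.count right = k := by
      rw [ht, List.count_append, count_right_depthSteps, List.count_replicate]
      simp
    cases x with
    | U =>
      refine ⟨h, h0, hm, t + 1, ?_⟩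
      have : (L ++ [DyckStep.U]).count right = k := by simp [hc]
      rw [this, List.replicate_succ', ← List.append_assoc, ← ht]
    | D =>
      have : (L ++ [DyckStep.D]).count right = k + 1 := by simp [hc]
      -- The new right-step closes a column that absorbs the `t` pending down-steps; beyond `k` the
      -- function is constant to stay monotone.
      refine ⟨fun l => if l ≤ k then h l else h k + t, by simp [h0], ?_, 0, ?_⟩
      · intro a b hab
        have h1 := hm hab
        dsimp only
        split_ifs with ha hb hb
        · exact h1
        · exact (hm ha).trans (Nat.le_add_right _ _)
        · omega
        · exact le_rfl
      · rw [this, depthSteps]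
        have e : depthSteps (fun l => if l ≤ k then h l else h k + t) k = depthSteps h k :=
          depthSteps_congr fun l hl => by simp [hl]
        rw [e]
        simp [ht]

/-- The number of peaks of a step sequence on the `d`-th diagonal. -/
def listPeaks (L : List DyckStep) (d : ℕ) : ℕ :=
  #{m ∈ range L.length | L[m]? = some down ∧ L[m + 1]? = some right ∧
    (L.take m).count down = (L.take m).count right + d}

/-- The last step alone never starts a peak, so appending `y` can only create the peak `x y`, which
starts at the end of `L`. -/
theorem listPeaks_append_two (L : List DyckStep) (x y : DyckStep) (d : ℕ) :
    listPeaks (L ++ [x] ++ [y]) d = listPeaks (L ++ [x]) d +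
      if x = down ∧ y = right ∧ L.count down = L.count right + d then 1 else 0 := by
  simp only [listPeaks, card_filter, List.length_append, List.length_singleton, sum_range_succ]
  have hlast : (L ++ [x] ++ [y])[L.length + 1 + 1]? = none := by simp
  have hlast' : (L ++ [x])[L.length + 1]? = none := by simp
  have h1 : (L ++ [x] ++ [y])[L.length]? = some x := by simp
  have h2 : (L ++ [x] ++ [y])[L.length + 1]? = some y := by
    rw [List.getElem?_append_right (by simp)]
    simp
  have h3 : (L ++ [x] ++ [y]).take L.length = L := by simp
  rw [hlast, hlast', h1, h2, h3]
  simp only [reduceCtorEq, false_and, and_false, if_false, add_zero, Option.some.injEq]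
  congr 1
  refine sum_congr rfl fun m hm => ?_
  rw [mem_range] at hm
  rw [List.getElem?_append_left (l₁ := L ++ [x]) (i := m) (by simp; omega),
    List.getElem?_append_left (l₁ := L ++ [x]) (i := m + 1) (by simp; omega),
    List.take_append_of_le_length (l₁ := L ++ [x]) (by simp; omega)]

theorem listPeaks_append_down (L : List DyckStep) (a d : ℕ) :
    listPeaks (L ++ List.replicate a down) d = listPeaks L d := by
  induction a with
  | zero => simp
  | succ a ih =>
    rw [List.replicate_succ', ← List.append_assoc, ← ih]
    generalize L ++ List.replicate a down = M
    rcases List.eq_nil_or_concat M with rfl | ⟨M', x, rfl⟩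
    · simp [listPeaks]
    · rw [List.concat_eq_append, listPeaks_append_two, if_neg (by simp), add_zero]

/-- A nonempty run of down-steps before a right-step gives one peak. It starts before the last
down-step of the run, at depth `h (k + 1) - 1` after `k` right-steps, whence the `+ 1`. -/
theorem listPeaks_depthSteps {h : ℕ → ℕ} (h0 : h 0 = 0) (hm : Monotone h) (d n : ℕ) :
    listPeaks (depthSteps h n) d = #{k ∈ range n | h k < h (k + 1) ∧ h (k + 1) = k + d + 1} := by
  rw [card_filter]
  induction n with
  | zero => simp [listPeaks, depthSteps]
  | succ n ih =>
    rw [sum_range_succ, ← ih, depthSteps]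
    have hle := hm (Nat.le_succ n)
    have hcd := count_down_depthSteps h0 hm n
    have hcr := count_right_depthSteps h n
    rcases hle.eq_or_lt with he | hlt
    · simp only [Nat.succ_eq_add_one] at he
      rw [← he, Nat.sub_self, if_neg (by simp), List.replicate_zero, List.nil_append, add_zero]
      cases n with
      | zero => simp [depthSteps, listPeaks]
      | succ n =>
        rw [depthSteps, ← List.append_assoc, listPeaks_append_two, if_neg (by simp), add_zero]
    -- Splitting off the last down-step exposes the new peak; the `a` others create none.
    · obtain ⟨a, ha⟩ : ∃ a, h (n + 1) = h n + (a + 1) := ⟨h (n + 1) - h n - 1, by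
        simp only [Nat.succ_eq_add_one] at hlt; omega⟩
      rw [ha, Nat.add_sub_cancel_left, List.replicate_succ', ← List.append_assoc,
        ← List.append_assoc, listPeaks_append_two, List.append_assoc, ← List.replicate_succ',
        listPeaks_append_down]
      congr 1
      simp only [List.count_append, hcd, hcr, List.count_replicate]
      refine if_congr ?_ rfl rfl
      simp
      omega

/-! ### Reconstructing a permutation from its running minima -/

/-- `m k` is the minimum of the entries of `σ` up to position `k`. -/
def IsRunningMin {n : ℕ} (σ : Equiv.Perm (Fin n)) (m : Fin n → Fin n) : Prop :=
  ∀ k, (∀ i ≤ k, m k ≤ σ i) ∧ ∃ i ≤ k, σ i = m k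

/-- Every entry of `s` is selected by `sel` among the unused values that are at least `m k`. -/
def IsGreedy {n : ℕ} (sel : Fin n → Finset (Fin n) → Fin n) (m s : Fin n → Fin n) : Prop :=
  ∀ k, s k = sel (m k) {v | m k ≤ v ∧ ∀ i, i < k → s i ≠ v}

/-- The sequence produced by a selection rule. -/
noncomputable def greedy {n : ℕ} (sel : Fin n → Finset (Fin n) → Fin n) (m : Fin n → Fin n)
    (k : Fin n) : Fin n :=
  open Classical in
  sel (m k) (univ.filter fun v => m k ≤ v ∧ ∀ i : {i // i < k}, greedy sel m i.1 ≠ v)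
termination_by k.val
decreasing_by all_goals exact Subtype.prop (p := fun i => i < k) _

theorem isGreedy_greedy {n : ℕ} (sel : Fin n → Finset (Fin n) → Fin n) (m : Fin n → Fin n) :
    IsGreedy sel m (greedy sel m) := by
  intro k
  rw [greedy]
  simp only [Subtype.forall]

theorem IsGreedy.unique {n : ℕ} {sel : Fin n → Finset (Fin n) → Fin n} {m s t : Fin n → Fin n}
    (hs : IsGreedy sel m s) (ht : IsGreedy sel m t) : s = t := by
  funext k
  induction k using WellFoundedLT.induction with
  | ind k ih =>
    rw [hs k, ht k]
    congr 1
    refine filter_congr fun v _ => and_congr_right fun _ => forall₂_congr fun i hi => ?_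
    rw [ih i hi]

/-- There are `n - m k` values from `m k` upwards, and at most `k` of them have been used. -/
theorem exists_unused {n : ℕ} (s m : Fin n → Fin n) (k : Fin n) (hk : k.val + (m k).val < n) :
    ({v | m k ≤ v ∧ ∀ i, i < k → s i ≠ v} : Finset (Fin n)).Nonempty := by
  classical
  have hlt : #((Iio k).image s) < #(Ici (m k)) := by
    refine card_image_le.trans_lt ?_
    rw [Fin.card_Iio, Fin.card_Ici]
    omega
  obtain ⟨v, hv, hv'⟩ := exists_mem_notMem_of_card_lt_card hlt
  refine ⟨v, ?_⟩
  simp only [mem_Ici, mem_image, mem_Iio, not_exists, not_and] at hv hv'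
  simp only [mem_filter, mem_univ, true_and]
  exact ⟨hv, hv'⟩

/-- Unused values keep the sequence injective, and antitonicity of `m` keeps earlier entries at or
above `m k`. The hypothesis `hself` makes `m k` actually occur: if it is still unused at position
`k`, it is the least candidate and gets selected. -/
theorem exists_greedy_perm {n : ℕ} {sel : Fin n → Finset (Fin n) → Fin n}
    (hsel : ∀ v S, S.Nonempty → sel v S ∈ S)
    (hself : ∀ v S, v ∈ S → (∀ w ∈ S, v ≤ w) → sel v S = v) {m : Fin n → Fin n}
    (hm : Antitone m) (hmn : ∀ k, k.val + (m k).val < n) :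
    ∃ σ : Equiv.Perm (Fin n), IsRunningMin σ m ∧ IsGreedy sel m σ := by
  have hg := isGreedy_greedy sel m
  set s := greedy sel m
  have hmem : ∀ k, m k ≤ s k ∧ ∀ i, i < k → s i ≠ s k := by
    intro k
    have := hsel (m k) _ (exists_unused s m k (hmn k))
    rw [← hg k] at this
    simpa using this
  have hinj : Function.Injective s := by
    intro a b hab
    rcases lt_trichotomy a b with h | h | h
    · exact absurd hab ((hmem b).2 a h)
    · exact h
    · exact absurd hab.symm ((hmem a).2 b h)
  refine ⟨Equiv.ofBijective s (Finite.injective_iff_bijective.1 hinj), fun k => ⟨?_, ?_⟩, hg⟩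
  · exact fun i hi => (hm hi).trans (hmem i).1
  · change ∃ i ≤ k, s i = m k
    by_cases h : ∃ i, i < k ∧ s i = m k
    · obtain ⟨i, hi, he⟩ := h
      exact ⟨i, hi.le, he⟩
    · push Not at h
      refine ⟨k, le_rfl, ?_⟩
      rw [hg k]
      refine hself _ _ ?_ ?_
      · simpa using h
      · intro w hw
        simp only [mem_filter, mem_univ, true_and] at hw
        exact hw.1

/-- Select the smallest value. -/
def selectMin {n : ℕ} (v : Fin n) (S : Finset (Fin n)) : Fin n :=
  if h : S.Nonempty then S.min' h else v

/-- Select `v` if possible, otherwise the largest value. -/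
def selectMax {n : ℕ} (v : Fin n) (S : Finset (Fin n)) : Fin n :=
  if v ∈ S then v else if h : S.Nonempty then S.max' h else v

theorem selectMin_mem {n : ℕ} (v : Fin n) (S : Finset (Fin n)) (h : S.Nonempty) :
    selectMin v S ∈ S := by
  rw [selectMin, dif_pos h]
  exact min'_mem S h

theorem selectMax_mem {n : ℕ} (v : Fin n) (S : Finset (Fin n)) (h : S.Nonempty) :
    selectMax v S ∈ S := by
  rw [selectMax]
  split_ifs with hv
  · exact hv
  · exact max'_mem S h

theorem selectMin_eq {n : ℕ} {v w : Fin n} {S : Finset (Fin n)} (hw : w ∈ S)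
    (hle : ∀ u ∈ S, w ≤ u) : selectMin v S = w := by
  have h : S.Nonempty := ⟨w, hw⟩
  rw [selectMin, dif_pos h]
  exact le_antisymm (min'_le S w hw) (hle _ (min'_mem S h))

theorem selectMax_eq_self {n : ℕ} {v : Fin n} {S : Finset (Fin n)} (hv : v ∈ S) :
    selectMax v S = v := if_pos hv

theorem selectMax_eq {n : ℕ} {v w : Fin n} {S : Finset (Fin n)} (hv : v ∉ S) (hw : w ∈ S)
    (hle : ∀ u ∈ S, u ≤ w) : selectMax v S = w := by
  have h : S.Nonempty := ⟨w, hw⟩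
  rw [selectMax, if_neg hv, dif_pos h]
  exact le_antisymm (hle _ (max'_mem S h)) (le_max' S w hw)

theorem exists_gt_of_unused {n : ℕ} {σ : Equiv.Perm (Fin n)} {k v : Fin n}
    (h : ∀ i, i < k → σ i ≠ v) (hne : v ≠ σ k) : ∃ c, k < c ∧ σ c = v := by
  refine ⟨σ.symm v, ?_, by simp⟩
  by_contra! hle
  rcases hle.lt_or_eq with hlt | he
  · exact h _ hlt (by simp)
  · exact hne (by rw [← he]; simp)

/-- A candidate smaller than `σ k` would appear later and complete a 132 with the running minimum
and `σ k`. Conversely, the last entry of a 132 is a candidate at the middle position that is smaller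
than the value chosen there. -/
theorem mem_avoiders_p132_iff_isGreedy {n : ℕ} {σ : Equiv.Perm (Fin n)} {m : Fin n → Fin n}
    (hm : IsRunningMin σ m) : σ ∈ avoiders n p132 ↔ IsGreedy selectMin m σ := by
  rw [mem_avoiders_p132]
  constructor
  · intro h k
    refine (selectMin_eq ?_ ?_).symm
    · simp only [mem_filter, mem_univ, true_and]
      exact ⟨(hm k).1 k le_rfl, fun i hi e => hi.ne (σ.injective e)⟩
    · intro u hu
      simp only [mem_filter, mem_univ, true_and] at hu
      by_contra! hlt
      obtain ⟨c, hc, rfl⟩ := exists_gt_of_unused hu.2 hlt.ne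
      obtain ⟨a, ha, hea⟩ := (hm k).2
      have hac : σ a < σ c :=
        lt_of_le_of_ne (hea ▸ hu.1) fun e => (ha.trans_lt hc).ne (σ.injective e)
      have hak : a < k := lt_of_le_of_ne ha (by rintro rfl; exact lt_asymm hac hlt)
      exact h a k c hak hc hac hlt
  · intro hg a b c hab hbc hac hcb
    have hc : σ c ∈ ({v | m b ≤ v ∧ ∀ i, i < b → σ i ≠ v} : Finset (Fin n)) := by
      simp only [mem_filter, mem_univ, true_and]
      exact ⟨((hm b).1 a hab.le).trans hac.le, fun i hi e => (hi.trans hbc).ne (σ.injective e)⟩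
    have hb := hg b
    rw [selectMin, dif_pos ⟨_, hc⟩] at hb
    exact absurd (min'_le _ _ hc) (by rw [← hb]; exact not_le.2 hcb)

/-- If `σ k` is not the running minimum, a larger candidate would appear later and complete a 123.
Conversely, the middle entry of a 123 is neither the running minimum nor the largest candidate,
since the last entry is a larger one. -/
theorem mem_avoiders_p123_iff_isGreedy {n : ℕ} {σ : Equiv.Perm (Fin n)} {m : Fin n → Fin n}
    (hm : IsRunningMin σ m) : σ ∈ avoiders n p123 ↔ IsGreedy selectMax m σ := by
  rw [mem_avoiders_p123]
  constructor
  · intro h k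
    obtain ⟨a, ha, hea⟩ := (hm k).2
    by_cases hak : a = k
    · subst hak
      rw [selectMax_eq_self, hea]
      simp only [mem_filter, mem_univ, true_and]
      exact ⟨le_rfl, fun i hi e => hi.ne (σ.injective (e.trans hea.symm))⟩
    · have hak : a < k := lt_of_le_of_ne ha hak
      have hlt : σ a < σ k :=
        lt_of_le_of_ne (hea ▸ (hm k).1 k le_rfl) fun e => hak.ne (σ.injective e)
      refine (selectMax_eq ?_ ?_ ?_).symm
      · simp only [mem_filter, mem_univ, true_and]
        exact fun H => H.2 a hak hea
      · simp only [mem_filter, mem_univ, true_and]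
        exact ⟨(hm k).1 k le_rfl, fun i hi e => hi.ne (σ.injective e)⟩
      · intro u hu
        simp only [mem_filter, mem_univ, true_and] at hu
        by_contra! hku
        obtain ⟨c, hc, rfl⟩ := exists_gt_of_unused hu.2 hku.ne'
        exact h a k c hak hc hlt hku
  · intro hg a b c hab hbc h1 h2
    have hc : σ c ∈ ({v | m b ≤ v ∧ ∀ i, i < b → σ i ≠ v} : Finset (Fin n)) := by
      simp only [mem_filter, mem_univ, true_and]
      exact ⟨((hm b).1 b le_rfl).trans h2.le, fun i hi e => (hi.trans hbc).ne (σ.injective e)⟩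
    have hb := hg b
    rw [selectMax] at hb
    split_ifs at hb with hv hne
    · exact absurd ((hm b).1 a hab.le) (by rw [← hb]; exact not_le.2 h1)
    · exact absurd (le_max' _ _ hc) (by rw [← hb]; exact not_le.2 h2)
    · exact hne ⟨_, hc⟩

/-! ### The boundary path -/

theorem monotone_shadedDepth {n : ℕ} (σ : Equiv.Perm (Fin n)) : Monotone (shadedDepth σ) :=
  monotone_nat_of_le_succ (shadedDepth_mono σ)

theorem exists_isRunningMin {n : ℕ} (σ : Equiv.Perm (Fin n)) : ∃ m, IsRunningMin σ m := by
  have : ∀ k, ∃ v, (∀ i ≤ k, v ≤ σ i) ∧ ∃ i ≤ k, σ i = v := by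
    intro k
    obtain ⟨a, ha, h⟩ := exists_min_image (Iic k) σ ⟨k, by simp⟩
    exact ⟨σ a, fun i hi => h i (by simpa using hi), a, by simpa using ha, rfl⟩
  choose m hm using this
  exact ⟨m, hm⟩

theorem IsRunningMin.shadedDepth_succ {n : ℕ} {σ : Equiv.Perm (Fin n)} {m : Fin n → Fin n}
    (hm : IsRunningMin σ m) (k : Fin n) : shadedDepth σ (k + 1) = n - m k := by
  rw [shadedDepth, ← Fin.card_Ici]
  congr 1
  ext r
  simp only [mem_filter, mem_univ, true_and, mem_Ici]
  constructor
  · rintro ⟨i, hi, hr⟩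
    exact ((hm k).1 i (Fin.le_def.2 (by omega))).trans hr
  · intro hr
    obtain ⟨i, hi, he⟩ := (hm k).2
    exact ⟨i, by have := Fin.le_def.1 hi; omega, he ▸ hr⟩

theorem shadedDepth_eq_of_boundaryPath_eq {n : ℕ} {σ τ : Equiv.Perm (Fin n)}
    (h : boundaryPath σ = boundaryPath τ) {k : ℕ} (hk : k ≤ n) :
    shadedDepth σ k = shadedDepth τ k := by
  have h' : boundarySteps σ n = boundarySteps τ n := congrArg DyckWord.toList h
  rw [boundarySteps_eq, boundarySteps_eq] at h'
  exact depthSteps_injective (shadedDepth_zero σ) (monotone_shadedDepth σ) (shadedDepth_zero τ)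
    (monotone_shadedDepth τ) h' hk

theorem IsRunningMin.eq_of_boundaryPath_eq {n : ℕ} {σ τ : Equiv.Perm (Fin n)}
    {m m' : Fin n → Fin n} (hm : IsRunningMin σ m) (hm' : IsRunningMin τ m')
    (h : boundaryPath σ = boundaryPath τ) : m = m' := by
  funext k
  have := shadedDepth_eq_of_boundaryPath_eq h (k := k + 1) (by omega)
  rw [hm.shadedDepth_succ, hm'.shadedDepth_succ] at this
  ext
  omega

theorem exists_isRunningMin_boundaryPath {n : ℕ} (P : DyckWord) (hP : P.semilength = n) :
    ∃ m : Fin n → Fin n, Antitone m ∧ (∀ k, k.val + (m k).val < n) ∧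
      ∀ σ, IsRunningMin σ m → boundaryPath σ = P := by
  obtain ⟨h, h0, hm, t, ht⟩ := exists_depthSteps P.toList
  have hU : P.toList.count down = n := hP
  have hD : P.toList.count right = n := P.count_U_eq_count_D.symm.trans hP
  rw [hD] at ht
  have hle : ∀ k ≤ n, k ≤ h k := by
    intro k hk
    have hp : depthSteps h k <+: P.toList := by
      rw [ht]
      exact (depthSteps_prefix h hk).trans (List.prefix_append _ _)
    have := P.count_D_le_count_U (depthSteps h k).length
    rw [← List.prefix_iff_eq_take.1 hp] at this
    rwa [count_right_depthSteps, count_down_depthSteps h0 hm] at this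
  have hn := hle n le_rfl
  -- The total of `n` down-steps together with `n ≤ h n` leaves no trailing down-steps.
  have hc := hU
  rw [ht, List.count_append, count_down_depthSteps h0 hm, List.count_replicate_self] at hc
  have hhn : h n = n := by omega
  obtain rfl : t = 0 := by omega
  rw [List.replicate_zero, List.append_nil] at ht
  -- This choice is forced by `IsRunningMin.shadedDepth_succ`. The bound `k + 1 ≤ h (k + 1)` gives
  -- both `m k < n` and `k + m k < n`.
  refine ⟨fun k => ⟨n - h (k + 1), ?_⟩, ?_, ?_, ?_⟩
  · have := hle (k + 1) (by omega)
    omega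
  · intro a b hab
    have := hm (Nat.succ_le_succ (Fin.le_def.1 hab))
    simp only [Nat.succ_eq_add_one] at this
    rw [Fin.le_def]
    dsimp only
    omega
  · intro k
    have := hle (k + 1) (by omega)
    dsimp only
    omega
  · intro σ hσ
    refine DyckWord.ext ?_
    change boundarySteps σ n = _
    rw [boundarySteps_eq, ht]
    refine depthSteps_congr fun l hl => ?_
    cases l with
    | zero => rw [shadedDepth_zero, h0]
    | succ l =>
      have h1 := hσ.shadedDepth_succ ⟨l, hl⟩
      have h2 := hm hl
      dsimp only at h1
      omega

theorem semilength_boundaryPath {n : ℕ} (σ : Equiv.Perm (Fin n)) :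
    (boundaryPath σ).semilength = n :=
  (count_down_boundarySteps σ n).trans (shadedDepth_self σ)

/-- A class of permutations described by a greedy rule is in bijection with the Dyck paths. -/
theorem bijOn_boundaryPath_of_isGreedy {n : ℕ} {sel : Fin n → Finset (Fin n) → Fin n}
    (hsel : ∀ v S, S.Nonempty → sel v S ∈ S)
    (hself : ∀ v S, v ∈ S → (∀ w ∈ S, v ≤ w) → sel v S = v) {A : Finset (Equiv.Perm (Fin n))}
    (hA : ∀ σ m, IsRunningMin σ m → (σ ∈ A ↔ IsGreedy sel m σ)) :
    Set.BijOn boundaryPath (A : Set (Equiv.Perm (Fin n))) {P | P.semilength = n} := by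
  refine ⟨fun σ _ => semilength_boundaryPath σ, ?_, ?_⟩
  · intro σ hσ τ hτ he
    obtain ⟨m, hm⟩ := exists_isRunningMin σ
    obtain ⟨m', hm'⟩ := exists_isRunningMin τ
    obtain rfl := hm.eq_of_boundaryPath_eq hm' he
    exact DFunLike.coe_injective (((hA σ m hm).1 hσ).unique ((hA τ m hm').1 hτ))
  · intro P hP
    obtain ⟨m, hanti, hlt, hpath⟩ := exists_isRunningMin_boundaryPath P hP
    obtain ⟨σ, hσ, hg⟩ := exists_greedy_perm hsel hself hanti hlt
    exact ⟨σ, (hA σ m hσ).2 hg, hpath σ hσ⟩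

theorem bijOn_boundaryPath_p132 (n : ℕ) :
    Set.BijOn boundaryPath (avoiders n p132 : Set (Equiv.Perm (Fin n))) {P | P.semilength = n} :=
  bijOn_boundaryPath_of_isGreedy selectMin_mem (fun _ _ => selectMin_eq)
    fun _ _ => mem_avoiders_p132_iff_isGreedy

theorem bijOn_boundaryPath_p123 (n : ℕ) :
    Set.BijOn boundaryPath (avoiders n p123 : Set (Equiv.Perm (Fin n))) {P | P.semilength = n} :=
  bijOn_boundaryPath_of_isGreedy selectMax_mem (fun _ _ hv _ => selectMax_eq_self hv)
    fun _ _ => mem_avoiders_p123_iff_isGreedy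

/-! ### Peaks of the boundary path -/

theorem shadedDepth_lt_succ_iff {n : ℕ} (σ : Equiv.Perm (Fin n)) (k : Fin n) :
    shadedDepth σ k < shadedDepth σ (k + 1) ↔ IsLeftMin σ k := by
  constructor
  · intro h i hi
    by_contra! hle
    refine h.ne ?_
    rw [shadedDepth, shadedDepth]
    congr 1
    ext r
    simp only [mem_filter, mem_univ, true_and]
    constructor
    · rintro ⟨a, ha, hr⟩
      exact ⟨a, by omega, hr⟩
    · rintro ⟨a, ha, hr⟩
      rcases Nat.lt_succ_iff_lt_or_eq.1 ha with ha | ha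
      · exact ⟨a, ha, hr⟩
      · obtain rfl : a = k := Fin.ext ha
        exact ⟨i, hi, hle.trans hr⟩
  · intro h
    refine card_lt_card ((ssubset_iff_of_subset ?_).2 ⟨σ k, ?_, ?_⟩)
    · intro r hr
      simp only [mem_filter, mem_univ, true_and] at hr ⊢
      obtain ⟨a, ha, hr⟩ := hr
      exact ⟨a, by omega, hr⟩
    · simp only [mem_filter, mem_univ, true_and]
      exact ⟨k, by omega, le_rfl⟩
    · simp only [mem_filter, mem_univ, true_and, not_exists, not_and, not_le]
      exact fun i hi => h i hi

/-- The shaded rows are the values at least `σ k`. At a left-to-right minimum these are the entries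
at all `k + 1` positions up to `k`, and those in `largerRight σ k`. -/
theorem IsLeftMin.shadedDepth_succ {n : ℕ} {σ : Equiv.Perm (Fin n)} {k : Fin n}
    (h : IsLeftMin σ k) : shadedDepth σ (k + 1) = k + #(largerRight σ k) + 1 := by
  have hle : ∀ i ≤ k, σ k ≤ σ i := fun i hi =>
    hi.lt_or_eq.elim (fun hi => (h i hi).le) fun e => e ▸ le_rfl
  have hset : ({r | ∃ i : Fin n, i.val < k + 1 ∧ σ i ≤ r} : Finset (Fin n)) =
      (Iic k ∪ largerRight σ k).map σ.toEmbedding := by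
    ext r
    obtain ⟨c, rfl⟩ := σ.surjective r
    simp only [mem_filter, mem_univ, true_and, mem_map_equiv, Equiv.symm_apply_apply, mem_union,
      mem_Iic, largerRight]
    constructor
    · rintro ⟨i, hi, hr⟩
      refine (le_or_gt c k).imp_right fun hc => ⟨hc, ?_⟩
      exact lt_of_le_of_ne ((hle i (Fin.le_def.2 (by omega))).trans hr)
        fun e => hc.ne (σ.injective e)
    · rintro (hc | hc)
      · exact ⟨k, by omega, hle c hc⟩
      · exact ⟨k, by omega, hc.2.le⟩
  rw [shadedDepth, hset, card_map, card_union_of_disjoint, Fin.card_Iic]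
  · omega
  · rw [disjoint_left]
    intro c hc hc'
    simp only [mem_Iic, largerRight, mem_filter, mem_univ, true_and] at hc hc'
    exact absurd hc'.1 (not_lt.2 hc)

open Classical in
theorem peaksOnDiagonal_boundaryPath {n : ℕ} (σ : Equiv.Perm (Fin n)) (d : ℕ) :
    peaksOnDiagonal (boundaryPath σ) d = #{k | IsLeftMin σ k ∧ #(largerRight σ k) = d} := by
  change listPeaks (boundarySteps σ n) d = _
  rw [boundarySteps_eq, listPeaks_depthSteps (shadedDepth_zero σ) (monotone_shadedDepth σ),
    card_filter, card_filter, ← Fin.sum_univ_eq_sum_range (fun k => if shadedDepth σ k <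
      shadedDepth σ (k + 1) ∧ shadedDepth σ (k + 1) = k + d + 1 then 1 else 0) n]
  refine sum_congr rfl fun k _ => if_congr ?_ rfl rfl
  rw [shadedDepth_lt_succ_iff]
  refine and_congr_right fun h => ?_
  rw [h.shadedDepth_succ]
  omega

/-! ### Conclusion -/

theorem occr_eq_iff_boundaryPath_mem {n i j : ℕ} (hij : i < j + 1) {σ : Equiv.Perm (Fin n)}
    {γ : Equiv.Perm (Fin (j + 1))}
    (h : ∀ f, IsOccurrence γ σ f ↔ StrictMono f ∧ ∀ a : Fin j, σ (f 0) < σ (f a.succ)) :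
    occr γ σ = i ↔ boundaryPath σ ∈ pathsWithTopPeaks n i (j + 1) := by
  rw [occr_eq_sum_choose σ γ h, sum_choose_eq_iff hij]
  simp only [pathsWithTopPeaks, Set.mem_ofPred_eq, semilength_boundaryPath, true_and,
    peaksOnDiagonal_boundaryPath, Nat.add_sub_cancel]

theorem bijOn_pathsWithTopPeaks {n i j : ℕ} {A : Finset (Equiv.Perm (Fin n))}
    {γ : Equiv.Perm (Fin j)} (hA : Set.BijOn boundaryPath (A : Set (Equiv.Perm (Fin n))) {P | P.semilength = n})
    (h : ∀ σ ∈ A, occr γ σ = i ↔ boundaryPath σ ∈ pathsWithTopPeaks n i j) :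
    Set.BijOn boundaryPath {σ | σ ∈ A ∧ occr γ σ = i} (pathsWithTopPeaks n i j) := by
  refine ⟨fun σ hσ => (h σ hσ.1).1 hσ.2, hA.injOn.mono fun σ hσ => hσ.1, fun P hP => ?_⟩
  obtain ⟨σ, hσ, rfl⟩ := hA.surjOn hP.1
  exact ⟨σ, ⟨hσ, (h σ hσ).2 hP⟩, rfl⟩

theorem coeff_Qpoly {m j : ℕ} (τ : Equiv.Perm (Fin m)) (γ : Equiv.Perm (Fin j)) (n i : ℕ) :
    (Qpoly τ γ n).coeff i = #{σ ∈ avoiders n τ | occr γ σ = i} := by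
  simp [Qpoly, Polynomial.coeff_X_pow, eq_comm]

end PermPattern

theorem mainTheorem5 (n i j : ℕ) (hij : i < j) :
    -- the coefficients of `t ^ n x ^ i` in the two generating functions agree
    (PowerSeries.coeff n (PermPattern.Q PermPattern.p132 (PermPattern.increasing j))).coeff i =
      (PowerSeries.coeff n
        (PermPattern.Q PermPattern.p123 (PermPattern.oneThenDecreasing j))).coeff i ∧
    -- the two sets of permutations are equinumerous
    #{σ ∈ PermPattern.avoiders n PermPattern.p132 |
        PermPattern.occr (PermPattern.increasing j) σ = i} =
      #{σ ∈ PermPattern.avoiders n PermPattern.p123 |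
        PermPattern.occr (PermPattern.oneThenDecreasing j) σ = i} ∧
    -- both are characterized by the same property of the associated Dyck path
    (∀ σ ∈ PermPattern.avoiders n PermPattern.p132,
      PermPattern.occr (PermPattern.increasing j) σ = i ↔
        PermPattern.boundaryPath σ ∈ PermPattern.pathsWithTopPeaks n i j) ∧
    (∀ σ ∈ PermPattern.avoiders n PermPattern.p123,
      PermPattern.occr (PermPattern.oneThenDecreasing j) σ = i ↔
        PermPattern.boundaryPath σ ∈ PermPattern.pathsWithTopPeaks n i j) ∧
    -- and both correspond bijectively to the Dyck paths with that property
    Set.BijOn PermPattern.boundaryPath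
      {σ : Equiv.Perm (Fin n) | σ ∈ PermPattern.avoiders n PermPattern.p132 ∧
        PermPattern.occr (PermPattern.increasing j) σ = i}
      (PermPattern.pathsWithTopPeaks n i j) ∧
    Set.BijOn PermPattern.boundaryPath
      {σ : Equiv.Perm (Fin n) | σ ∈ PermPattern.avoiders n PermPattern.p123 ∧
        PermPattern.occr (PermPattern.oneThenDecreasing j) σ = i}
      (PermPattern.pathsWithTopPeaks n i j) := by
  -- From `i < j` the pattern is nonempty, so it has a first entry.
  obtain ⟨j, rfl⟩ : ∃ j', j = j' + 1 := ⟨j - 1, by omega⟩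
  have h132 := fun σ hσ => PermPattern.occr_eq_iff_boundaryPath_mem hij
    (PermPattern.isOccurrence_increasing_iff (n := n) (σ := σ) hσ)
  have h123 := fun σ hσ => PermPattern.occr_eq_iff_boundaryPath_mem hij
    (PermPattern.isOccurrence_oneThenDecreasing_iff (n := n) (σ := σ) hσ)
  have b132 := PermPattern.bijOn_pathsWithTopPeaks (PermPattern.bijOn_boundaryPath_p132 n) h132
  have b123 := PermPattern.bijOn_pathsWithTopPeaks (PermPattern.bijOn_boundaryPath_p123 n) h123
  have hcard : #{σ ∈ PermPattern.avoiders n PermPattern.p132 |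
        PermPattern.occr (PermPattern.increasing (j + 1)) σ = i} =
      #{σ ∈ PermPattern.avoiders n PermPattern.p123 |
        PermPattern.occr (PermPattern.oneThenDecreasing (j + 1)) σ = i} := by
    rw [← Set.ncard_coe_finset, ← Set.ncard_coe_finset, coe_filter, coe_filter,
      ← b132.injOn.ncard_image, ← b123.injOn.ncard_image, b132.image_eq, b123.image_eq]
  refine ⟨?_, hcard, h132, h123, b132, b123⟩
  rw [PermPattern.Q, PermPattern.Q, PowerSeries.coeff_mk, PowerSeries.coeff_mk]
  -- For `n = 0` both coefficients come from the constant term 1.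
  split_ifs
  · rfl
  · rw [PermPattern.coeff_Qpoly, PermPattern.coeff_Qpoly, hcard]
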